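/- Let $C_0\ge 1$ and let $L\in C^2(\mathbb T^d\times\mathbb R^d)$ satisfy $D^2_{vv}L(x,v)\ge \frac1{C_0}\mathrm{Id}$ and $\frac1{C_0}(1+|v|^2)\le L(x,v)\le C_0(1+|v|^2)$ for all $(x,v)$. Let $F:\mathbb T^d\times\mathcal P(\mathbb T^d)\to\mathbb R$ be continuous, where $\mathcal P(\mathbb T^d)$ carries the weak topology. For $N\ge2$, $1\le i\le N$ and $m_1,\dots,m_N\in\mathcal P(\mathbb T^d)$ put $$V^i[m_1,\dots,m_N](x)=\int_{\mathbb T^{d(N-1)}}F\Big(x,\frac1{N-1}\sum_{j\ne i}\delta_{x_j}\Big)\prod_{j\ne i}m_j(dx_j).$$ For every $N\ge 2$ let $U_N\in C^2(\mathbb T^d)$ be any function and let $\mathscr I_N$ be the set of Borel probability measures on $\mathbb T^d\times\mathbb R^d$ that are invariant under the Euler–Lagrange flow of the Lagrangian $L(x,v)+U_N(x)$ (for instance $U_N=0$, or $U_N$ the coupling term of the cost when that is of class $C^2$). Let $\pi:\mathbb T^d\times\mathbb R^d\to\mathbb T^d$ be the projection. For each $N\ge2$ let $\overline\mu^N\in\mathscr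 I_N$ be such that $(\overline\mu^N,\dots,\overline\mu^N)$ is a (symmetric) Nash equilibrium in mixed strategies of the $N$-player game, i.e. for every $i$ and every $\eta\in\mathscr I_N$, $$\int \big(L(x,v)+V^i[\pi\sharp\overline\mu^N,\dots,\pi\sharp\overline\mu^N](x)\big)\,\overline\mu^N(dx,dv)\le\int \big(L(x,v)+V^i[\pi\sharp\overline\mu^N,\dots,\pi\sharp\overline\mu^N](x)\big)\,\eta(dx,dv),$$ the integrals taking values in $(-\infty,+\infty]$. Then: 1. the family $\{\overline\mu^N\}_{N\ge2}$ is tight; 2. there are a subsequence $(\overline\mu^{N_k})_k$ and a Borel probability measure $\overline\mu$ on $\mathbb T^d\times\mathbb R^d$ with $\overline\mu^{N_k}\rightharpoonup\overline\mu$ weakly; 3. for every subsequence $(\overline\mu^{N_k})_k$ converging weakly to a probability measure $\overline\mu$, every $x\in\mathbb T^d$ and every choice of indices $i_k\in\{1,\dots,N_k\}$, $$V^{i_k}[\pi\sharp\overline\mu^{N_k},\dots,\pi\sharp\overline\mu^{N_k}](x)\longrightarrow F(x,\pi\sharp\overline\mu)\qquad(k\to\infty).$$ -/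

import Mathlib

open MeasureTheory Filter Topology
open scoped ENNReal

noncomputable section

/-- The velocity space `ℝ^d` with its Euclidean norm. -/
abbrev Vel (d : ℕ) := EuclideanSpace ℝ (Fin d)

/-- The flat torus `𝕋^d = ℝ^d / ℤ^d`. -/
abbrev Torus (d : ℕ) := UnitAddTorus (Fin d)

/-- The phase space `𝕋^d × ℝ^d` of one player. -/
abbrev Phase (d : ℕ) := Torus d × Vel d

/-- The quotient map `ℝ^d → 𝕋^d`. -/
def toTorus {d : ℕ} (x : Vel d) : Torus d := fun k => (x k : UnitAddCircle)

/-- A Lagrangian on `𝕋^d × ℝ^d`, read on the universal cover `ℝ^d × ℝ^d`. -/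
def liftLagrangian {d : ℕ} (ℓ : Phase d → ℝ) : Vel d × Vel d → ℝ :=
  fun p => ℓ (toTorus p.1, p.2)

/-- The standing assumptions on a Lagrangian with constant `C₀ ≥ 1`: it is of class `C²` on
`𝕋^d × ℝ^d` (that is, its lift to `ℝ^d × ℝ^d` is), `D²_{vv} L ≥ Id / C₀`, and
`(1 + |v|²) / C₀ ≤ L(x, v) ≤ C₀ (1 + |v|²)`. -/
structure IsAdmissibleLagrangian {d : ℕ} (C₀ : ℝ) (L : Phase d → ℝ) : Prop where
  one_le : 1 ≤ C₀
  contDiff : ContDiff ℝ 2 (liftLagrangian L)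
  hessian_ge : ∀ (x : Torus d) (v w : Vel d),
    (1 / C₀) * ‖w‖ ^ 2 ≤ fderiv ℝ (fderiv ℝ fun u : Vel d => L (x, u)) v w w
  lower : ∀ (x : Torus d) (v : Vel d), (1 / C₀) * (1 + ‖v‖ ^ 2) ≤ L (x, v)
  upper : ∀ (x : Torus d) (v : Vel d), L (x, v) ≤ C₀ * (1 + ‖v‖ ^ 2)

/-- `γ : ℝ → ℝ^d` is (the lift of) a solution, defined for all times, of the Euler–Lagrange equation
`d/dt D_v ℓ(γ, γ') = D_x ℓ(γ, γ')`. -/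
def IsExtremal {d : ℕ} (ℓ : Phase d → ℝ) (γ : ℝ → Vel d) : Prop :=
  ContDiff ℝ 2 γ ∧
    ∀ t : ℝ,
      HasDerivAt (fun s => fderiv ℝ (fun u : Vel d => liftLagrangian ℓ (γ s, u)) (deriv γ s))
        (fderiv ℝ (fun y : Vel d => liftLagrangian ℓ (y, deriv γ t)) (γ t)) t

open Classical in
/-- The Euler flow `φ_t` of a Lagrangian `ℓ`: `φ_t (x, v) = (γ(t), γ'(t))`, where `γ` is the solution
of the Euler–Lagrange equation with `γ(0) = x`, `γ'(0) = v`. For a `C²` Lagrangian which is uniformly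
convex and superlinear in `v` this solution exists for all times and is unique (up to the choice of a
lift, which does not affect the value), so that the second branch is never used. -/
def eulerFlow {d : ℕ} (ℓ : Phase d → ℝ) (t : ℝ) (p : Phase d) : Phase d :=
  if h : ∃ γ : ℝ → Vel d, IsExtremal ℓ γ ∧ toTorus (γ 0) = p.1 ∧ deriv γ 0 = p.2 then
    (toTorus (h.choose t), deriv h.choose t)
  else p

/-- A Borel probability measure `μ` is invariant for the flow `Φ`: `μ(B) = μ(Φ_t(B))` for every time
`t` and every Borel set `B`. -/
def IsFlowInvariant {d : ℕ} (Φ : ℝ → Phase d → Phase d) (μ : ProbabilityMeasure (Phase d)) : Prop :=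
  ∀ (t : ℝ) (B : Set (Phase d)), MeasurableSet B →
    (μ : Measure (Phase d)) B = (μ : Measure (Phase d)) (Φ t '' B)

/-- The marginal `π ♯ μ` on `𝕋^d`. -/
def spaceMarginal {d : ℕ} (μ : ProbabilityMeasure (Phase d)) : ProbabilityMeasure (Torus d) :=
  μ.map (f := Prod.fst) measurable_fst.aemeasurable

/-- The configuration `(x_1, …, x_{i-1}, y, x_{i+1}, …)`. -/
def insertPosition {ι X : Type*} [DecidableEq ι] (i : ι) (y : X) (x : {j : ι // j ≠ i} → X) :
    ι → X :=
  fun j => if h : j = i then y else x ⟨j, h⟩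

/-- The averaged coupling
`V^i[(m_j)_j](y) = ∫ F^i(x_1, …, x_{i-1}, y, x_{i+1}, …) ∏_{j ≠ i} m_j(dx_j)`. -/
def averagedCoupling {ι : Type*} [Fintype ι] [DecidableEq ι] {d : ℕ} (F : ι → (ι → Torus d) → ℝ)
    (i : ι) (m : ι → ProbabilityMeasure (Torus d)) (y : Torus d) : ℝ :=
  ∫ x : {j : ι // j ≠ i} → Torus d, F i (insertPosition i y x)
    ∂(Measure.pi fun j : {j : ι // j ≠ i} => (m j : Measure (Torus d)))

/-- The Lebesgue integral `∫ f dη ∈ [-∞, ∞]`, positive part minus negative part. -/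
def extendedIntegral {X : Type*} [MeasurableSpace X] (η : Measure X) (f : X → ℝ) : EReal :=
  ((∫⁻ p, ENNReal.ofReal (f p) ∂η : ℝ≥0∞) : EReal) -
    ((∫⁻ p, ENNReal.ofReal (-f p) ∂η : ℝ≥0∞) : EReal)

/-- The payoff in mixed strategies
`J^i((μ_j)_j, (η_j)_j) = ∫ (L^i(x, v) + V^i[π♯μ_1, …, π♯μ_N](x)) η_i(dx, dv)`.
The integrand is bounded below when `L^i` is admissible and `F^i` is continuous, so that the value is
a well-defined element of `(-∞, ∞]`. -/
def payoff {ι : Type*} [Fintype ι] [DecidableEq ι] {d : ℕ} (L : ι → Phase d → ℝ)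
    (F : ι → (ι → Torus d) → ℝ) (i : ι) (μ η : ι → ProbabilityMeasure (Phase d)) : EReal :=
  extendedIntegral (η i : Measure (Phase d)) fun p =>
    L i p + averagedCoupling F i (fun j => spaceMarginal (μ j)) p.1

/-- `(μ_j)_j` is a Nash equilibrium in mixed strategies for the game with Lagrangians `L^i` and
couplings `F^i`, where the strategies of player `i` are the probability measures invariant for the
flow `Φ^i`. -/
def IsMixedNashEquilibrium {ι : Type*} [Fintype ι] [DecidableEq ι] {d : ℕ}
    (Φ : ι → ℝ → Phase d → Phase d) (L : ι → Phase d → ℝ) (F : ι → (ι → Torus d) → ℝ)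
    (μ : ι → ProbabilityMeasure (Phase d)) : Prop :=
  (∀ i, IsFlowInvariant (Φ i) (μ i)) ∧
    ∀ (i : ι) (η : ProbabilityMeasure (Phase d)), IsFlowInvariant (Φ i) η →
      payoff L F i μ μ ≤ payoff L F i μ (Function.update μ i η)

/-- The empirical measure `(1 / |κ|) ∑_{j ∈ κ} δ_{x_j}`. -/
def empiricalProbability {κ X : Type*} [Fintype κ] [Nonempty κ] [MeasurableSpace X] (x : κ → X) :
    ProbabilityMeasure X :=
  ⟨(Fintype.card κ : ℝ≥0∞)⁻¹ • ∑ j, Measure.dirac (x j), by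
    constructor
    simp only [Measure.smul_apply, Measure.coe_finsetSum, Finset.sum_apply, measure_univ,
      Finset.sum_const, Finset.card_univ, nsmul_eq_mul, mul_one, smul_eq_mul]
    exact ENNReal.inv_mul_cancel (by simp [Fintype.card_ne_zero]) (by simp)⟩

/-- The symmetric mean field coupling `F^i(x_1, …, x_N) = F(x_i, 1/(N-1) ∑_{j ≠ i} δ_{x_j})`. -/
def meanFieldCoupling {ι : Type*} [Fintype ι] [DecidableEq ι] [Nontrivial ι] {d : ℕ}
    (F : Torus d → ProbabilityMeasure (Torus d) → ℝ) (i : ι) (x : ι → Torus d) : ℝ :=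
  haveI : Nonempty {j : ι // j ≠ i} := nonempty_subtype.2 (exists_ne i)
  F (x i) (empiricalProbability fun j : {j : ι // j ≠ i} => x j)

end

/-!
Tightness. The second moment in `v` of an equilibrium strategy is controlled by its cost, as `L` is
coercive and `F` is bounded, being continuous on the compact space `𝕋^d × 𝒫(𝕋^d)`. The cost is at most
that of any invariant competitor, so it is enough to find invariant measures whose cost is bounded
independently of the number of players and of the potential `U`. A Dirac mass at `(x₀, 0)`, where `x₀`
is a maximum of `ℓ(·, 0)` for `ℓ = L + U`, is one: the energy `D_v ℓ · v - ℓ` is conserved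
(`IsExtremal.lagrangianEnergy_eq`) and by strict convexity it exceeds `-ℓ(x, 0) ≥ -ℓ(x₀, 0)` wherever
`v ≠ 0` (`neg_apply_zero_lt_fderiv_sub`), so that an extremal through `(x₀, 0)` never moves
(`IsExtremal.eq_of_rest_at_max`). The cost of this competitor is at most `C₀ + max |F|`, because
`L(x₀, 0) ≤ C₀`.
Prokhorov's theorem turns tightness into a convergent subsequence.

Limits of the couplings. The averaged coupling is the expectation of `F(x, ·)` at the empirical measure
of `N - 1` independent points of law `π♯μ^N`. As `π♯μ^N` converges weakly and `N → ∞`, that empirical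
measure converges in probability to the limit law, by Chebyshev's inequality for each bounded
continuous test function (`tendsto_measure_empiricalProbability_notMem`), and bounded convergence gives
the claim (`tendsto_integral_empiricalProbability`).
-/

/-! ### Rest points of the Euler flow -/

lemma isOpenQuotientMap_toTorus {d : ℕ} : IsOpenQuotientMap (toTorus (d := d)) := by
  have h : IsOpenQuotientMap (Pi.map fun (_ : Fin d) (x : ℝ) => (x : UnitAddCircle)) :=
    IsOpenQuotientMap.piMap fun _ => QuotientAddGroup.isOpenQuotientMap_mk
  exact h.comp (EuclideanSpace.equiv (Fin d) ℝ).toHomeomorph.isOpenQuotientMap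

/-- The energy `D_v ℓ(x, v) · v - ℓ(x, v)` of a Lagrangian `ℓ`, as a function on the universal cover
`ℝ^d × ℝ^d`. -/
noncomputable def lagrangianEnergy {d : ℕ} (ℓ : Phase d → ℝ) (p : Vel d × Vel d) : ℝ :=
  fderiv ℝ (fun u : Vel d => liftLagrangian ℓ (p.1, u)) p.2 p.2 - liftLagrangian ℓ p

/-- Conservation of energy. Only the momentum `D_v ℓ(γ, γ')` as a whole is differentiated, by the
Euler–Lagrange equation, so that no second derivative of `ℓ` appears. -/
lemma IsExtremal.lagrangianEnergy_eq {d : ℕ} {ℓ : Phase d → ℝ} {γ : ℝ → Vel d}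
    (hℓ : ContDiff ℝ 2 (liftLagrangian ℓ)) (hγ : IsExtremal ℓ γ) (s t : ℝ) :
    lagrangianEnergy ℓ (γ s, deriv γ s) = lagrangianEnergy ℓ (γ t, deriv γ t) := by
  have key : ∀ t, HasDerivAt (fun s => lagrangianEnergy ℓ (γ s, deriv γ s)) 0 t := by
    intro t
    have h1 : HasDerivAt γ (deriv γ t) t :=
      (hγ.1.differentiable (by norm_num) t).hasDerivAt
    have h2 : HasDerivAt (deriv γ) (deriv (deriv γ) t) t := by
      have : ContDiff ℝ 1 (deriv γ) := ((contDiff_succ_iff_deriv (n := 1)).1 hγ.1).2.2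
      exact (this.differentiable (by norm_num) t).hasDerivAt
    have hd : HasFDerivAt (liftLagrangian ℓ) (fderiv ℝ (liftLagrangian ℓ) (γ t, deriv γ t))
        (γ t, deriv γ t) := (hℓ.differentiable (by norm_num) _).hasFDerivAt
    have hx : HasFDerivAt (fun y : Vel d => liftLagrangian ℓ (y, deriv γ t))
        ((fderiv ℝ (liftLagrangian ℓ) (γ t, deriv γ t)).comp (.inl ℝ _ _)) (γ t) :=
      HasFDerivAt.comp (γ t) (f := fun y : Vel d => (y, deriv γ t)) hd
        (hasFDerivAt_prodMk_left _ _)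
    have hv : HasFDerivAt (fun u : Vel d => liftLagrangian ℓ (γ t, u))
        ((fderiv ℝ (liftLagrangian ℓ) (γ t, deriv γ t)).comp (.inr ℝ _ _)) (deriv γ t) :=
      HasFDerivAt.comp (deriv γ t) (f := fun u : Vel d => (γ t, u)) hd
        (hasFDerivAt_prodMk_right _ _)
    have hc : HasDerivAt (fun s => liftLagrangian ℓ (γ s, deriv γ s)) _ t :=
      HasFDerivAt.comp_hasDerivAt (l := liftLagrangian ℓ) (f := fun s => (γ s, deriv γ s)) t hd
        (h1.prodMk h2)
    have := ((hγ.2 t).clm_apply h2).sub hc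
    refine this.congr_deriv ?_
    rw [hx.fderiv, hv.fderiv]
    simp only [ContinuousLinearMap.comp_apply, ContinuousLinearMap.inl_apply,
      ContinuousLinearMap.inr_apply]
    rw [← map_add]
    simp
  exact is_const_of_deriv_eq_zero (fun t => (key t).differentiableAt) (fun t => (key t).deriv) s t

/-- A function that is strictly convex along `ℝ v` lies strictly above its tangent at `v`, at the point
`0`. The derivative of `s ↦ s g'(s v) v - g(s v)` is `s g''(s v)(v, v) > 0` on `(0, 1)`. -/
lemma neg_apply_zero_lt_fderiv_sub {E : Type*} [NormedAddCommGroup E] [NormedSpace ℝ E]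
    {g : E → ℝ} (hg : ContDiff ℝ 2 g) {v : E} (hconv : ∀ u, 0 < fderiv ℝ (fderiv ℝ g) u v v) :
    -g 0 < fderiv ℝ g v v - g v := by
  have hg' : Differentiable ℝ (fderiv ℝ g) :=
    (hg.fderiv_right (m := 1) (by norm_num)).differentiable (by norm_num)
  have hline (s : ℝ) : HasDerivAt (fun s : ℝ => s • v) v s := by
    simpa using (hasDerivAt_id s).smul_const v
  have hder (s : ℝ) : HasDerivAt (fun s : ℝ => fderiv ℝ g (s • v) (s • v) - g (s • v))
      (s * fderiv ℝ (fderiv ℝ g) (s • v) v v) s := by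
    have a : HasDerivAt (fun s : ℝ => fderiv ℝ g (s • v)) (fderiv ℝ (fderiv ℝ g) (s • v) v) s :=
      HasFDerivAt.comp_hasDerivAt (l := fderiv ℝ g) s (hg' (s • v)).hasFDerivAt (hline s)
    have b : HasDerivAt (fun s : ℝ => g (s • v)) (fderiv ℝ g (s • v) v) s :=
      HasFDerivAt.comp_hasDerivAt (l := g) s
        (hg.differentiable (by norm_num) (s • v)).hasFDerivAt (hline s)
    refine ((a.clm_apply (hline s)).sub b).congr_deriv ?_
    simp
  obtain ⟨s, hs, h⟩ := exists_hasDerivAt_eq_slope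
    (fun s : ℝ => fderiv ℝ g (s • v) (s • v) - g (s • v)) _ zero_lt_one
    (fun s _ => (hder s).continuousAt.continuousWithinAt) (fun s _ => hder s)
  have := mul_pos hs.1 (hconv (s • v))
  rw [h] at this
  simp only [one_smul, zero_smul, map_zero] at this
  linarith

section Rest
variable {d : ℕ} {ℓ : Phase d → ℝ}

/-- An extremal that is at rest, at some time, over a maximum `x₀` of `ℓ(·, 0)` is constant: its energy
is the constant `-ℓ(x₀, 0) ≤ -ℓ(x, 0)`, whereas the energy at `(x, v)` exceeds `-ℓ(x, 0)` as soon as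
`v ≠ 0`. No uniqueness theorem for the Euler–Lagrange equation is needed. -/
lemma IsExtremal.eq_of_rest_at_max (hℓ : ContDiff ℝ 2 (liftLagrangian ℓ))
    (hconv : ∀ x u v : Vel d, v ≠ 0 →
      0 < fderiv ℝ (fderiv ℝ fun w : Vel d => liftLagrangian ℓ (x, w)) u v v)
    {x₀ : Torus d} (hx₀ : ∀ x, ℓ (x, 0) ≤ ℓ (x₀, 0)) {γ : ℝ → Vel d} (hγ : IsExtremal ℓ γ)
    {t : ℝ} (ht : (toTorus (γ t), deriv γ t) = (x₀, (0 : Vel d))) (s : ℝ) :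
    (toTorus (γ s), deriv γ s) = (x₀, (0 : Vel d)) := by
  rw [Prod.mk.injEq] at ht
  have hzero : ∀ s, deriv γ s = 0 := by
    intro s
    by_contra hne
    have h1 : -liftLagrangian ℓ (γ s, 0) < lagrangianEnergy ℓ (γ s, deriv γ s) :=
      neg_apply_zero_lt_fderiv_sub (g := fun w => liftLagrangian ℓ (γ s, w))
        (hℓ.comp (contDiff_const.prodMk contDiff_id)) (fun u => hconv _ u _ hne)
    rw [hγ.lagrangianEnergy_eq hℓ s t, ht.2] at h1
    have h2 := hx₀ (toTorus (γ s))
    simp only [lagrangianEnergy, liftLagrangian, map_zero, ht.1] at h1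
    linarith
  have hconst : γ s = γ t :=
    is_const_of_deriv_eq_zero (hγ.1.differentiable (by norm_num)) hzero s t
  rw [hconst, hzero s, ht.1]

/-- A maximum of `ℓ(·, 0)`, at rest, is fixed by the Euler flow and has no other preimage. -/
lemma eulerFlow_eq_rest_iff (hℓ : ContDiff ℝ 2 (liftLagrangian ℓ))
    (hconv : ∀ x u v : Vel d, v ≠ 0 →
      0 < fderiv ℝ (fderiv ℝ fun w : Vel d => liftLagrangian ℓ (x, w)) u v v)
    {x₀ : Torus d} (hx₀ : ∀ x, ℓ (x, 0) ≤ ℓ (x₀, 0)) (t : ℝ) (p : Phase d) :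
    eulerFlow ℓ t p = (x₀, 0) ↔ p = (x₀, 0) := by
  unfold eulerFlow
  split_ifs with h
  · obtain ⟨hγ, h1, h2⟩ := h.choose_spec
    have hp : p = (toTorus (h.choose 0), deriv h.choose 0) := Prod.ext h1.symm h2.symm
    constructor
    · intro ht
      rw [hp]
      exact hγ.eq_of_rest_at_max hℓ hconv hx₀ ht 0
    · intro hp'
      exact hγ.eq_of_rest_at_max hℓ hconv hx₀ (hp.symm.trans hp') t
  · exact Iff.rfl

end Rest

/-- Since invariance compares `B` with its forward image, the fixed point must also be its only
preimage. -/
lemma isFlowInvariant_dirac {d : ℕ} {Φ : ℝ → Phase d → Phase d} {p₀ : Phase d}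
    (h : ∀ t p, Φ t p = p₀ ↔ p = p₀) :
    IsFlowInvariant Φ (diracProba p₀) := by
  intro t B _
  have : p₀ ∈ Φ t '' B ↔ p₀ ∈ B := by
    simp [Set.mem_image, h]
  by_cases hB : p₀ ∈ B <;> simp [diracProba, Measure.dirac_apply, hB, this]

/-- Whatever the potential `U`, some Dirac mass on the zero section is invariant for the flow of
`L + U`. -/
lemma IsAdmissibleLagrangian.exists_dirac_isFlowInvariant {d : ℕ} {C₀ : ℝ} {L : Phase d → ℝ}
    (hL : IsAdmissibleLagrangian C₀ L) {U : Torus d → ℝ}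
    (hU : ContDiff ℝ 2 fun x : Vel d => U (toTorus x)) :
    ∃ x₀ : Torus d, IsFlowInvariant (eulerFlow fun p => L p + U p.1) (diracProba (x₀, 0)) := by
  set ℓ : Phase d → ℝ := fun p => L p + U p.1 with hℓdef
  have hℓ : ContDiff ℝ 2 (liftLagrangian ℓ) := hL.contDiff.add (hU.comp contDiff_fst)
  have hconv : ∀ x u v : Vel d, v ≠ 0 →
      0 < fderiv ℝ (fderiv ℝ fun w : Vel d => liftLagrangian ℓ (x, w)) u v v := by
    intro x u v hv
    have h1 := hL.hessian_ge (toTorus x) u v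
    have h2 : (fderiv ℝ fun w : Vel d => liftLagrangian ℓ (x, w)) =
        fderiv ℝ fun w : Vel d => L (toTorus x, w) := by
      ext1 w
      exact fderiv_add_const (U (toTorus x))
    rw [h2]
    have := hL.one_le
    refine lt_of_lt_of_le ?_ h1
    positivity
  have hcont : Continuous fun x : Torus d => ℓ (x, 0) := by
    rw [isOpenQuotientMap_toTorus.isQuotientMap.continuous_iff]
    exact hℓ.continuous.comp (continuous_id.prodMk continuous_const)
  obtain ⟨x₀, hx₀⟩ := hcont.exists_forall_ge_of_hasCompactSupport
    (HasCompactSupport.of_compactSpace _)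
  exact ⟨x₀, isFlowInvariant_dirac (eulerFlow_eq_rest_iff hℓ hconv hx₀)⟩

/-! ### Law of large numbers for empirical measures -/

section LLN
open ProbabilityTheory BoundedContinuousFunction

lemma integral_empiricalProbability {κ X : Type*} [Fintype κ] [Nonempty κ] [MeasurableSpace X]
    (x : κ → X) {f : X → ℝ} (hf : StronglyMeasurable f) :
    ∫ y, f y ∂(empiricalProbability x : Measure X) = (Fintype.card κ : ℝ)⁻¹ * ∑ j, f (x j) := by
  simp only [empiricalProbability, ProbabilityMeasure.coe_mk]
  rw [integral_smul_measure, integral_finsetSum_measure]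
  · simp [integral_dirac' _ _ hf]
  · intro j _
    exact (integrable_dirac' hf (by simp))

lemma continuous_empiricalProbability {κ X : Type*} [Fintype κ] [Nonempty κ] [TopologicalSpace X]
    [MeasurableSpace X] [BorelSpace X] :
    Continuous (empiricalProbability : (κ → X) → ProbabilityMeasure X) := by
  rw [continuous_iff_continuousAt]
  intro x
  rw [ContinuousAt, ProbabilityMeasure.tendsto_iff_forall_integral_tendsto]
  intro f
  simp_rw [integral_empiricalProbability _ f.continuous.stronglyMeasurable]
  exact (by fun_prop : Continuous fun y : κ → X => (Fintype.card κ : ℝ)⁻¹ * ∑ j, f (y j)).tendsto x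

/-- The average of `f` over `|κ|` independent points of law `m` has variance at most `‖f‖² / |κ|`. -/
lemma variance_integral_empiricalProbability_le {κ X : Type*} [Fintype κ] [Nonempty κ]
    [TopologicalSpace X] [MeasurableSpace X] [BorelSpace X] (m : ProbabilityMeasure X)
    (f : X →ᵇ ℝ) :
    Var[fun x : κ → X => ∫ y, f y ∂(empiricalProbability x : Measure X);
      Measure.pi fun _ => (m : Measure X)] ≤ ‖f‖ ^ 2 / Fintype.card κ := by
  simp_rw [integral_empiricalProbability _ f.continuous.stronglyMeasurable]
  have hf : MemLp f 2 (m : Measure X) :=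
    MemLp.of_bound f.continuous.stronglyMeasurable.aestronglyMeasurable ‖f‖
      (ae_of_all _ f.norm_coe_le_norm)
  have h1 : Var[f; (m : Measure X)] ≤ ‖f‖ ^ 2 := by
    refine (variance_le_expectation_sq hf.aestronglyMeasurable).trans ?_
    refine (integral_mono_of_nonneg (ae_of_all _ fun x => sq_nonneg _)
      (integrable_const (‖f‖ ^ 2)) (ae_of_all _ fun x => ?_)).trans (by simp)
    simpa using pow_le_pow_left₀ (norm_nonneg _) (f.norm_coe_le_norm x) 2
  have h2 : Var[fun x : κ → X => ∑ j, f (x j); Measure.pi fun _ => (m : Measure X)] =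
      Fintype.card κ * Var[f; (m : Measure X)] := by
    have := variance_sum_pi (μ := fun _ : κ => (m : Measure X)) (X := fun _ => f) fun _ => hf
    simpa [Finset.sum_fn] using this
  rw [variance_const_mul, h2]
  have hc : (0 : ℝ) < Fintype.card κ := by exact_mod_cast Fintype.card_pos
  rw [le_div_iff₀ hc]
  field_simp
  simpa using h1

lemma integral_integral_empiricalProbability {κ X : Type*} [Fintype κ] [Nonempty κ]
    [TopologicalSpace X] [MeasurableSpace X] [BorelSpace X] (m : ProbabilityMeasure X)
    (f : X →ᵇ ℝ) :
    ∫ x : κ → X, ∫ y, f y ∂(empiricalProbability x : Measure X)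
      ∂(Measure.pi fun _ => (m : Measure X)) = ∫ y, f y ∂(m : Measure X) := by
  simp_rw [integral_empiricalProbability _ f.continuous.stronglyMeasurable]
  have hmp (j : κ) := measurePreserving_eval (fun _ : κ => (m : Measure X)) j
  have hf : Integrable f (m : Measure X) := f.integrable _
  rw [integral_const_mul, integral_finsetSum]
  · have (j : κ) : ∫ x : κ → X, f (x j) ∂(Measure.pi fun _ => (m : Measure X)) =
        ∫ y, f y ∂(m : Measure X) := by
      have h := integral_map (μ := Measure.pi fun _ : κ => (m : Measure X)) (hmp j).measurable.aemeasurable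
        (f.continuous.stronglyMeasurable.aestronglyMeasurable (μ := Measure.map _ _))
      rw [(hmp j).map_eq] at h
      exact h.symm
    simp [this]
  · intro j _
    exact (hmp j).integrable_comp_of_integrable hf

/-- Chebyshev's inequality for the average of `f` over independent points of law `m`. -/
lemma measure_integral_empiricalProbability_le {κ X : Type*} [Fintype κ] [Nonempty κ]
    [TopologicalSpace X] [MeasurableSpace X] [BorelSpace X] (m : ProbabilityMeasure X)
    (f : X →ᵇ ℝ) {c : ℝ} (hc : 0 < c) :
    (Measure.pi fun _ : κ => (m : Measure X))
      {x | c ≤ |∫ y, f y ∂(empiricalProbability x : Measure X) - ∫ y, f y ∂(m : Measure X)|} ≤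
      ENNReal.ofReal (‖f‖ ^ 2 / Fintype.card κ / c ^ 2) := by
  have hm : MemLp (fun x : κ → X => ∫ y, f y ∂(empiricalProbability x : Measure X)) 2
      (Measure.pi fun _ : κ => (m : Measure X)) := by
    refine MemLp.of_bound ?_ ‖f‖ (ae_of_all _ fun x => ?_)
    · simp_rw [integral_empiricalProbability _ f.continuous.stronglyMeasurable]
      have : Measurable f := f.continuous.measurable
      exact Measurable.aestronglyMeasurable (by fun_prop)
    · simpa using norm_integral_le_of_norm_le_const (ae_of_all _ f.norm_coe_le_norm)
        (μ := (empiricalProbability x : Measure X))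
  have := meas_ge_le_variance_div_sq hm hc
  rw [integral_integral_empiricalProbability] at this
  refine this.trans (ENNReal.ofReal_le_ofReal ?_)
  gcongr
  exact variance_integral_empiricalProbability_le m f

/-- Weak law of large numbers for triangular arrays: if `m a → m₀` weakly and the number of points
tends to infinity, then the empirical measure of independent points of law `m a` converges to `m₀`
in probability, for the weak topology. -/
lemma tendsto_measure_empiricalProbability_notMem {X : Type*} [TopologicalSpace X]
    [MeasurableSpace X] [BorelSpace X] {α : Type*} {l : Filter α} {κ : α → Type*}
    [∀ a, Fintype (κ a)] [∀ a, Nonempty (κ a)]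
    (hκ : Tendsto (fun a => Fintype.card (κ a)) l atTop) {m : α → ProbabilityMeasure X}
    {m₀ : ProbabilityMeasure X} (hm : Tendsto m l (𝓝 m₀)) {O : Set (ProbabilityMeasure X)}
    (hO : O ∈ 𝓝 m₀) :
    Tendsto (fun a => (Measure.pi fun _ : κ a => (m a : Measure X))
      {x | empiricalProbability x ∉ O}) l (𝓝 0) := by
  -- The sets that contain the empirical measure with probability tending to `1` form a filter; it
  -- converges to `m₀` weakly, because it does so when tested against each bounded continuous function.
  let 𝓕 : Filter (ProbabilityMeasure X) :=
    { sets := {O | Tendsto (fun a => (Measure.pi fun _ : κ a => (m a : Measure X))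
        {x | empiricalProbability x ∉ O}) l (𝓝 0)}
      univ_sets := by simpa using tendsto_const_nhds
      sets_of_superset := fun {A B} hA hAB =>
        tendsto_of_tendsto_of_tendsto_of_le_of_le tendsto_const_nhds hA (fun _ => zero_le)
          fun a => measure_mono fun x hx hxA => hx (hAB hxA)
      inter_sets := fun {A B} hA hB => by
        have hAB := hA.add hB
        rw [add_zero] at hAB
        refine tendsto_of_tendsto_of_tendsto_of_le_of_le tendsto_const_nhds hAB
          (fun _ => zero_le) fun a => (measure_mono fun x hx => ?_).trans (measure_union_le _ _)
        by_contra h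
        simp only [Set.mem_union, not_or, Set.mem_ofPred_eq, not_not] at h
        exact hx h }
  suffices h : Tendsto id 𝓕 (𝓝 m₀) from h hO
  rw [ProbabilityMeasure.tendsto_iff_forall_integral_tendsto]
  intro f
  rw [Metric.tendsto_nhds]
  intro ε hε
  change Tendsto _ l (𝓝 0)
  have h0 : Tendsto (fun a => ENNReal.ofReal (‖f‖ ^ 2 / Fintype.card (κ a) / (ε / 2) ^ 2)) l
      (𝓝 0) := by
    have := ((tendsto_const_nhds (x := ‖f‖ ^ 2)).div_atTop
      (tendsto_natCast_atTop_atTop.comp hκ)).div_const ((ε / 2) ^ 2)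
    simpa using ENNReal.tendsto_ofReal this
  refine tendsto_of_tendsto_of_tendsto_of_le_of_le' tendsto_const_nhds h0
    (Eventually.of_forall fun _ => zero_le) ?_
  have hmf := ProbabilityMeasure.tendsto_iff_forall_integral_tendsto.1 hm f
  filter_upwards [Metric.tendsto_nhds.1 hmf (ε / 2) (half_pos hε)] with a ha
  refine (measure_mono fun x hx => ?_).trans
    (measure_integral_empiricalProbability_le (m a) f (half_pos hε))
  simp only [Set.mem_ofPred_eq, id, not_lt] at hx ⊢
  rw [← Real.dist_eq]
  have := dist_triangle (∫ y, f y ∂(empiricalProbability x : Measure X))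
    (∫ y, f y ∂(m a : Measure X)) (∫ y, f y ∂(m₀ : Measure X))
  linarith

/-- The expectation of a continuous function of the empirical measure converges to the value of the
function at the limit law. -/
theorem tendsto_integral_empiricalProbability {X : Type*} [TopologicalSpace X]
    [SecondCountableTopology X] [CompactSpace X] [T2Space X]
    [MeasurableSpace X] [BorelSpace X] {α : Type*} {l : Filter α} {κ : α → Type*}
    [∀ a, Fintype (κ a)] [∀ a, Nonempty (κ a)]
    (hκ : Tendsto (fun a => Fintype.card (κ a)) l atTop) {m : α → ProbabilityMeasure X}
    {m₀ : ProbabilityMeasure X} (hm : Tendsto m l (𝓝 m₀)) {G : ProbabilityMeasure X → ℝ}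
    (hG : Continuous G) :
    Tendsto (fun a => ∫ x, G (empiricalProbability x)
      ∂(Measure.pi fun _ : κ a => (m a : Measure X))) l (𝓝 (G m₀)) := by
  obtain ⟨M, hM⟩ := isCompact_univ.exists_bound_of_continuousOn hG.continuousOn
  replace hM : ∀ ν, ‖G ν‖ ≤ M := fun ν => hM ν trivial
  rw [Metric.tendsto_nhds]
  intro ε hε
  have hO : {ν | dist (G ν) (G m₀) < ε / 2} ∈ 𝓝 m₀ :=
    Metric.tendsto_nhds.1 (hG.tendsto m₀) _ (half_pos hε)
  have hlim := (ENNReal.tendsto_toReal ENNReal.zero_ne_top).comp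
    (tendsto_measure_empiricalProbability_notMem hκ hm hO)
  have hlim' := (hlim.const_mul (2 * M)).const_add (ε / 2)
  rw [ENNReal.toReal_zero, mul_zero, add_zero] at hlim'
  filter_upwards [hlim'.eventually_lt_const (half_lt_self hε)] with a ha
  refine lt_of_le_of_lt ?_ ha
  set P := Measure.pi fun _ : κ a => (m a : Measure X)
  set B : Set (κ a → X) := {x | empiricalProbability x ∉ {ν | dist (G ν) (G m₀) < ε / 2}}
  have hcont : Continuous fun x : κ a → X => G (empiricalProbability x) :=
    hG.comp continuous_empiricalProbability
  have hB : MeasurableSet B :=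
    by
    have : B = {x | ε / 2 ≤ dist (G (empiricalProbability x)) (G m₀)} := by
      ext
      simp [B]
    rw [this]
    exact (isClosed_le continuous_const (hcont.dist continuous_const)).measurableSet
  have hint : Integrable (fun x : κ a → X => G (empiricalProbability x)) P :=
    Integrable.of_bound hcont.aestronglyMeasurable M (ae_of_all _ fun x => hM _)
  have hbd : Integrable (fun x => ε / 2 + 2 * M * B.indicator (fun _ => (1 : ℝ)) x) P :=
    (integrable_const _).add (((integrable_const 1).indicator hB).const_mul _)
  calc dist (∫ x, G (empiricalProbability x) ∂P) (G m₀)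
      = ‖∫ x, (G (empiricalProbability x) - G m₀) ∂P‖ := by
        rw [integral_sub hint (integrable_const _), dist_eq_norm]
        simp
    _ ≤ ∫ x, (ε / 2 + 2 * M * B.indicator (fun _ => (1 : ℝ)) x) ∂P := by
        refine norm_integral_le_of_norm_le hbd (ae_of_all _ fun x => ?_)
        by_cases hx : x ∈ B
        · have := norm_sub_le (G (empiricalProbability x)) (G m₀)
          have h1 := hM (empiricalProbability x)
          have h2 := hM m₀
          simp only [Set.indicator_of_mem hx]
          linarith
        · simp only [Set.indicator_of_notMem hx, mul_zero, add_zero]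
          simp only [B, Set.mem_ofPred_eq, not_not] at hx
          rw [← dist_eq_norm]
          exact hx.le
    _ = _ := by
        rw [integral_add (integrable_const _) (((integrable_const 1).indicator hB).const_mul _),
          integral_const_mul, integral_indicator_const _ hB, integral_const]
        simp only [probReal_univ, smul_eq_mul, mul_one, one_mul]
        rfl
end LLN

/-! ### Moment bounds for equilibrium strategies -/

/-- A family of measures on the product of a compact space and a proper normed space is tight if its
second moments in the second variable are bounded. -/
lemma isTightMeasureSet_of_lintegral_sq_le {X E : Type*} [TopologicalSpace X] [CompactSpace X]
    [MeasurableSpace X] [NormedAddCommGroup E] [ProperSpace E] [MeasurableSpace E] [BorelSpace E]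
    {S : Set (Measure (X × E))} {C : ℝ≥0∞} (hC : C ≠ ∞)
    (hS : ∀ μ ∈ S, ∫⁻ p, ENNReal.ofReal (1 + ‖p.2‖ ^ 2) ∂μ ≤ C) : IsTightMeasureSet S := by
  rw [isTightMeasureSet_iff_exists_isCompact_measure_compl_le]
  intro ε hε
  have hlim : Tendsto (fun R : ℝ => C / ENNReal.ofReal (1 + R ^ 2)) atTop (𝓝 0) := by
    have h : Tendsto (fun R : ℝ => ENNReal.ofReal (1 + R ^ 2)) atTop (𝓝 ∞) :=
      ENNReal.tendsto_ofReal_atTop.comp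
        (tendsto_atTop_add_const_left _ _ (tendsto_pow_atTop two_ne_zero))
    simpa using ENNReal.Tendsto.const_div h (Or.inr hC)
  obtain ⟨R, hR, hR0⟩ := ((hlim.eventually_le_const hε).and (eventually_ge_atTop 0)).exists
  refine ⟨Set.univ ×ˢ Metric.closedBall 0 R, isCompact_univ.prod (isCompact_closedBall 0 R),
    fun μ hμ => ?_⟩
  calc μ (Set.univ ×ˢ Metric.closedBall 0 R)ᶜ
      ≤ μ {p | ENNReal.ofReal (1 + R ^ 2) ≤ ENNReal.ofReal (1 + ‖p.2‖ ^ 2)} := by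
        refine measure_mono fun p hp => ENNReal.ofReal_le_ofReal ?_
        simp only [Set.mem_compl_iff, Set.mem_prod, Set.mem_univ, true_and,
          mem_closedBall_zero_iff, not_le] at hp
        gcongr
    _ ≤ (∫⁻ p, ENNReal.ofReal (1 + ‖p.2‖ ^ 2) ∂μ) / ENNReal.ofReal (1 + R ^ 2) := by
        refine meas_ge_le_lintegral_div ?_ ?_ ENNReal.ofReal_ne_top
        · exact Measurable.aemeasurable (by fun_prop)
        · simp only [ne_eq, ENNReal.ofReal_eq_zero, not_le]
          positivity
    _ ≤ C / ENNReal.ofReal (1 + R ^ 2) := by gcongr; exact hS μ hμ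
    _ ≤ ε := hR

lemma abs_averagedCoupling_meanField_le {ι : Type*} [Fintype ι] [DecidableEq ι] [Nontrivial ι]
    {d : ℕ} {F : Torus d → ProbabilityMeasure (Torus d) → ℝ} {M : ℝ} (hM : ∀ x ν, |F x ν| ≤ M)
    (i : ι) (m : ι → ProbabilityMeasure (Torus d)) (y : Torus d) :
    |averagedCoupling (meanFieldCoupling F) i m y| ≤ M := by
  have := norm_integral_le_of_norm_le_const (C := M)
    (μ := Measure.pi fun j : {j : ι // j ≠ i} => (m j : Measure (Torus d)))
    (f := fun x => meanFieldCoupling F i (insertPosition i y x))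
    (ae_of_all _ fun x => hM _ _)
  simpa [averagedCoupling] using this

/-- A bound on the cost of a strategy, for a bounded coupling `V`, bounds its second moment in the
velocity. The negative part of the cost has integral at most `M`, hence the positive part has integral
at most `c + M`. -/
lemma lintegral_velocity_le {d : ℕ} {C₀ M c : ℝ} {L : Phase d → ℝ}
    (hL : IsAdmissibleLagrangian C₀ L) {V : Torus d → ℝ} (hV : ∀ x, |V x| ≤ M)
    {μ : ProbabilityMeasure (Phase d)} (hc : 0 ≤ c)
    (h : extendedIntegral (μ : Measure (Phase d)) (fun p => L p + V p.1) ≤ (c : EReal)) :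
    ∫⁻ p, ENNReal.ofReal (1 + ‖p.2‖ ^ 2) ∂(μ : Measure (Phase d)) ≤
      ENNReal.ofReal (C₀ * (c + 2 * M)) := by
  have hC₀ : 0 < C₀ := one_pos.trans_le hL.one_le
  have hM : 0 ≤ M := (abs_nonneg _).trans (hV 0)
  have hlow (p : Phase d) : 1 + ‖p.2‖ ^ 2 ≤ C₀ * L p := by
    have := hL.lower p.1 p.2
    rwa [one_div, inv_mul_le_iff₀ hC₀] at this
  have hneg : ∫⁻ p, ENNReal.ofReal (-(L p + V p.1)) ∂(μ : Measure (Phase d)) ≤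
      ENNReal.ofReal M := by
    refine (lintegral_mono (g := fun _ => ENNReal.ofReal M) fun p =>
      ENNReal.ofReal_le_ofReal ?_).trans (by simp)
    have h1 := (abs_le.1 (hV p.1)).1
    have h2 : 0 ≤ L p := by
      by_contra! hp
      nlinarith [hlow p, sq_nonneg ‖p.2‖]
    linarith
  have hpos : ∫⁻ p, ENNReal.ofReal (L p + V p.1) ∂(μ : Measure (Phase d)) ≤
      ENNReal.ofReal (c + M) := by
    have hneg' := hneg.trans_lt ENNReal.ofReal_lt_top
    rw [extendedIntegral, EReal.sub_le_iff_le_add (Or.inr (EReal.coe_ne_top c))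
      (Or.inl (by simpa using hneg'.ne))] at h
    have h2 : (c : EReal) = ((ENNReal.ofReal c : ℝ≥0∞) : EReal) := by
      rw [EReal.coe_ennreal_ofReal, max_eq_left hc]
    rw [h2, ← EReal.coe_ennreal_add, EReal.coe_ennreal_le_coe_ennreal_iff] at h
    refine h.trans ?_
    rw [ENNReal.ofReal_add hc hM]
    gcongr
  calc ∫⁻ p, ENNReal.ofReal (1 + ‖p.2‖ ^ 2) ∂(μ : Measure (Phase d))
      ≤ ∫⁻ p, ENNReal.ofReal C₀ * (ENNReal.ofReal (L p + V p.1) + ENNReal.ofReal M)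
          ∂(μ : Measure (Phase d)) := by
        refine lintegral_mono fun p => ?_
        have h1 := (abs_le.1 (hV p.1)).1
        calc ENNReal.ofReal (1 + ‖p.2‖ ^ 2) ≤ ENNReal.ofReal (C₀ * ((L p + V p.1) + M)) :=
              ENNReal.ofReal_le_ofReal ((hlow p).trans (by gcongr; linarith))
          _ ≤ _ := by
            rw [ENNReal.ofReal_mul hC₀.le]
            gcongr
            exact ENNReal.ofReal_add_le
    _ = ENNReal.ofReal C₀ * ((∫⁻ p, ENNReal.ofReal (L p + V p.1) ∂(μ : Measure (Phase d))) +
          ENNReal.ofReal M) := by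
        rw [lintegral_const_mul' _ _ ENNReal.ofReal_ne_top, lintegral_add_right _ measurable_const]
        simp
    _ ≤ ENNReal.ofReal C₀ * (ENNReal.ofReal (c + M) + ENNReal.ofReal M) := by gcongr
    _ = ENNReal.ofReal (C₀ * (c + 2 * M)) := by
        rw [← ENNReal.ofReal_add (by positivity) hM, ← ENNReal.ofReal_mul hC₀.le]
        ring_nf

lemma extendedIntegral_dirac_le {X : Type*} [MeasurableSpace X] [MeasurableSingletonClass X]
    {f : X → ℝ} {x : X} {c : ℝ} (hc : 0 ≤ c) (h : f x ≤ c) :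
    extendedIntegral (Measure.dirac x) f ≤ (c : EReal) := by
  rw [extendedIntegral, lintegral_dirac, lintegral_dirac]
  refine EReal.sub_le_of_le_add ?_
  rw [EReal.coe_ennreal_ofReal]
  exact le_add_of_le_of_nonneg (EReal.coe_le_coe_iff.2 (max_le h hc)) (EReal.coe_ennreal_nonneg _)

/-- The second moment of an equilibrium strategy is bounded independently of the number of players and
of the potential `U`: compare it with an invariant Dirac mass at some `(x₀, 0)`, whose cost is at most
`L(x₀, 0) + M ≤ C₀ + M`. -/
lemma IsMixedNashEquilibrium.lintegral_velocity_le {ι : Type*} [Fintype ι] [DecidableEq ι]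
    [Nontrivial ι] {d : ℕ} {C₀ M : ℝ} {L : Phase d → ℝ} (hL : IsAdmissibleLagrangian C₀ L)
    {F : Torus d → ProbabilityMeasure (Torus d) → ℝ} (hM : ∀ x ν, |F x ν| ≤ M)
    {U : Torus d → ℝ} (hU : ContDiff ℝ 2 fun x : Vel d => U (toTorus x))
    {μ : ι → ProbabilityMeasure (Phase d)}
    (hμ : IsMixedNashEquilibrium (fun _ => eulerFlow fun p => L p + U p.1) (fun _ => L)
      (meanFieldCoupling F) μ) (i : ι) :
    ∫⁻ p, ENNReal.ofReal (1 + ‖p.2‖ ^ 2) ∂(μ i : Measure (Phase d)) ≤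
      ENNReal.ofReal (C₀ * (C₀ + M + 2 * M)) := by
  obtain ⟨x₀, hx₀⟩ := hL.exists_dirac_isFlowInvariant hU
  have hV := abs_averagedCoupling_meanField_le hM i fun j => spaceMarginal (μ j)
  have hC₀ := hL.one_le
  have hM0 : 0 ≤ M := (abs_nonneg _).trans (hV 0)
  refine _root_.lintegral_velocity_le hL hV (by positivity) ((hμ.2 i _ hx₀).trans ?_)
  rw [payoff, Function.update_self]
  refine extendedIntegral_dirac_le (by positivity) ?_
  have h1 := hL.upper x₀ 0
  have h2 := (abs_le.1 (hV x₀)).2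
  simp only [norm_zero] at h1
  linarith

lemma averagedCoupling_meanFieldCoupling {ι : Type*} [Fintype ι] [DecidableEq ι] [Nontrivial ι]
    {d : ℕ} (F : Torus d → ProbabilityMeasure (Torus d) → ℝ) (i : ι)
    [Nonempty {j : ι // j ≠ i}] (m : ι → ProbabilityMeasure (Torus d)) (y : Torus d) :
    averagedCoupling (meanFieldCoupling F) i m y =
      ∫ x : {j : ι // j ≠ i} → Torus d, F y (empiricalProbability x)
        ∂(Measure.pi fun j : {j : ι // j ≠ i} => (m j : Measure (Torus d))) := by
  unfold averagedCoupling meanFieldCoupling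
  congr! 5 with x
  · simp [insertPosition]
  · rename_i j
    simp [insertPosition, j.2]

/-! ### Tightness and limits of symmetric equilibria -/

theorem proposition5p2 {d : ℕ} (C₀ : ℝ) (L : Phase d → ℝ) (hL : IsAdmissibleLagrangian C₀ L)
    (F : Torus d → ProbabilityMeasure (Torus d) → ℝ) (hF : Continuous (Function.uncurry F))
    -- In the game with `n + 2` players the flow that defines strategies is that of `L + U n`.
    (U : ℕ → Torus d → ℝ) (hU : ∀ n, ContDiff ℝ 2 fun x : Vel d => U n (toTorus x))
    -- `μ n` is the common strategy in a symmetric equilibrium of the game with `n + 2` players.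
    (μ : ℕ → ProbabilityMeasure (Phase d))
    (hμ : ∀ n : ℕ, IsMixedNashEquilibrium (ι := Fin (n + 2))
      (fun _ => eulerFlow fun p => L p + U n p.1) (fun _ => L) (meanFieldCoupling F)
      (fun _ => μ n)) :
    IsTightMeasureSet (Set.range fun n => (μ n : Measure (Phase d))) ∧
    (∃ (φ : ℕ → ℕ) (μbar : ProbabilityMeasure (Phase d)),
      StrictMono φ ∧ Tendsto (fun k => μ (φ k)) atTop (𝓝 μbar)) ∧
    (∀ (φ : ℕ → ℕ) (μbar : ProbabilityMeasure (Phase d)),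
      StrictMono φ → Tendsto (fun k => μ (φ k)) atTop (𝓝 μbar) →
      ∀ (i : ∀ k, Fin (φ k + 2)) (x : Torus d),
        Tendsto (fun k => averagedCoupling (meanFieldCoupling F) (i k)
            (fun _ => spaceMarginal (μ (φ k))) x)
          atTop (𝓝 (F x (spaceMarginal μbar)))) := by
  obtain ⟨M, hM⟩ := isCompact_univ.exists_bound_of_continuousOn hF.continuousOn
  have htight : IsTightMeasureSet (Set.range fun n => (μ n : Measure (Phase d))) := by
    refine isTightMeasureSet_of_lintegral_sq_le
      (C := ENNReal.ofReal (C₀ * (C₀ + M + 2 * M))) ENNReal.ofReal_ne_top ?_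
    rintro _ ⟨n, rfl⟩
    exact (hμ n).lintegral_velocity_le hL (fun x ν => hM (x, ν) trivial) (hU n) 0
  refine ⟨htight, ?_, ?_⟩
  · have hcomp : IsCompact (closure (Set.range μ)) :=
      isCompact_closure_of_isTightMeasureSet <| htight.subset <| by
        rintro _ ⟨_, ⟨n, rfl⟩, rfl⟩
        exact ⟨n, rfl⟩
    obtain ⟨μbar, -, φ, hφ, h⟩ :=
      hcomp.tendsto_subseq fun n => subset_closure (Set.mem_range_self n)
    exact ⟨φ, μbar, hφ, h⟩
  · intro φ μbar hφ hlim i x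
    have hne (k : ℕ) : Nonempty {j : Fin (φ k + 2) // j ≠ i k} :=
      nonempty_subtype.2 (exists_ne (i k))
    simp_rw [averagedCoupling_meanFieldCoupling]
    have hmarg : Tendsto (fun k => spaceMarginal (μ (φ k))) atTop (𝓝 (spaceMarginal μbar)) :=
      ProbabilityMeasure.tendsto_map_of_tendsto_of_continuous _ _ hlim continuous_fst
    refine tendsto_integral_empiricalProbability ?_ hmarg (hF.comp (Continuous.prodMk_right x))
    have hcard (k : ℕ) : Fintype.card {j : Fin (φ k + 2) // j ≠ i k} = φ k + 1 := by
      simp [Fintype.card_subtype_compl]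
    simp_rw [hcard]
    exact (tendsto_add_atTop_nat 1).comp hφ.tendsto_atTop
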